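/- **Setting.** Let $G=(V,E)$ be a finite directed graph of voters with edge weights $b_{uv}\in[0,1]$, $(u,v)\in E$, such that $\sum_{u:(u,v)\in E} b_{uv}\le 1$ for every $v\in V$. Let $C$ be a set of $m$ candidates with a target candidate $c_\star\in C$. Each voter $v$ has a preference list, in which $\pi_v(c)\in\{1,\dots,m\}$ is the position of $c$ (so $\pi_v:C\to\{1,\dots,m\}$ is a bijection). Let $\alpha:\{1,\dots,m\}\to[0,1]$ be any function and let $f:\{1,\dots,m\}\to\mathbb N$ be any nonincreasing scoring function. **Diffusion.** The thresholds $t_v$, $v\in V$, are independent and uniform on $[0,1]$. From a seed set $A_0\subseteq V$, the linear threshold process is given by $A_{n+1}=A_n\cup\{v: \sum_{u\in A_n,\,(u,v)\in E} b_{uv}\ge t_v\}$; let $A$ be the set of active nodes once it has stabilised. Put $s_v=\big\lfloor \frac{\alpha(\pi_v(c_\star))}{t_v}\sum_{u\in A,\,(u,v)\in E} b_{uv}\big\rfloor$. **Destructive control.** In the final list $\tilde\pi_v$ of $v$, the target has position $\tilde\pi_v(c_\star)=\pi_v(c_\star)+\min(m-\pi_v(c_\star),\,s_v)$, each candidate that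 it passes moves one position up, and all the others stay. Let $\mu(\emptyset)=\max_{c\ne c_\star}\sum_{v} f(\pi_v(c))-\sum_v f(\pi_v(c_\star))$ and $\mu(A_0)=\max_{c\ne c_\star}\sum_{v} f(\tilde\pi_v(c))-\sum_v f(\tilde\pi_v(c_\star))$ be the margins before and after the process (a maximum over no opponents is read as $0$ if $m=1$). For a budget $B\in\mathbb N$, destructive election control asks to maximize $\mathbb E[\mathrm{MoV}_D(A_0)]:=\mathbb E[\mu(A_0)-\mu(\emptyset)]$ subject to $|A_0|\le B$. **Reduction and Greedy.** Let $\pi'_v(c)=m-\pi_v(c)+1$, let $f'(r)=\max_{q} f(q)-f(m-r+1)$, and let $F'(A_0)=\mathbb E\big[\sum_{v} f'\big(\pi'_v(c_\star)-\min(\pi'_v(c_\star)-1,\,s_v)\big)\big]$ be the expected score of $c_\star$ in the constructive instance with lists $\pi'$ and scoring function $f'$, where $c_\star$ moves up and the numbers $s_v$ are the same as above (that is, the rate at position $\pi'_v(c_\star)$ is $\alpha(\pi_v(c_\star))$). $\textsc{Greedy}$ starts with $A_0=\emptyset$ and performs $\min(B,|V|)$ iterations, each of which adds to $A_0$ a node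 $v\in V\setminus A_0$ that maximizes $F'(A_0\cup\{v\})-F'(A_0)$, with ties broken arbitrarily. **Theorem.** $\textsc{Greedy}$ is a $\frac12\left(1-\frac1e\right)$-approximation algorithm for destructive election control: it always produces an output, and every possible output $A_0$ of $\textsc{Greedy}$ satisfies $|A_0|\le B$ and $$\mathbb E[\mathrm{MoV}_D(A_0)]\;\ge\;\frac12\left(1-\frac1e\right)\mathbb E[\mathrm{MoV}_D(S)]\qquad\text{for all } S\subseteq V \text{ with } |S|\le B.$$ -/

import Mathlib

open MeasureTheory

noncomputable section

open scoped Classical in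
/-- The data of an election on a social network. The voters are the nodes `V` of a directed graph,
`weight u v` is the weight `b_{uv}` of the edge `(u, v)`, and `C` is the set of candidates, with
`m = Fintype.card C`.  Positions in a preference list are elements of `Fin m`: the first position
(usually numbered `1`) is `0` and the last (usually numbered `m`) is `m - 1`, so the usual position
`π_v(c)` is `rank v c + 1`. -/
structure Election (V C : Type*) [Fintype V] [Fintype C] where
  /-- the social network -/
  graph : Digraph V
  /-- the edge weights; values on pairs that are not edges are never used -/
  weight : V → V → ℝ
  weight_mem : ∀ u v, graph.Adj u v → weight u v ∈ Set.Icc (0 : ℝ) 1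
  weight_sum_le : ∀ v, ∑ u with graph.Adj u v, weight u v ≤ 1
  /-- the preference list of each voter -/
  rank : V → C ≃ Fin (Fintype.card C)
  /-- the target candidate -/
  target : C
  /-- the rate `α` at which the target shifts, as a function of the target's position -/
  rate : Fin (Fintype.card C) → ℝ
  rate_mem : ∀ r, rate r ∈ Set.Icc (0 : ℝ) 1
  /-- the scoring function -/
  scoring : Fin (Fintype.card C) → ℕ
  scoring_antitone : Antitone scoring

namespace Election

variable {V C : Type*} [Fintype V] [Fintype C]

open scoped Classical in
/-- The total weight of the edges that enter `v` from nodes of `A`. -/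
def influence (I : Election V C) (A : Finset V) (v : V) : ℝ :=
  ∑ u ∈ A with I.graph.Adj u v, I.weight u v

open scoped Classical in
/-- One round of the Linear Threshold Model with thresholds `t`. -/
def ltmStep (I : Election V C) (t : V → ℝ) (A : Finset V) : Finset V :=
  A ∪ Finset.univ.filter fun v => t v ≤ I.influence A v

/-- The set `A_n` of the nodes that are active at time `n`, from the seed set `A₀`. -/
def activeAt (I : Election V C) (t : V → ℝ) (A₀ : Finset V) (n : ℕ) : Finset V :=
  (I.ltmStep t)^[n] A₀

theorem activeAt_succ (I : Election V C) (t : V → ℝ) (A₀ : Finset V) (n : ℕ) :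
    I.activeAt t A₀ (n + 1) = I.ltmStep t (I.activeAt t A₀ n) :=
  Function.iterate_succ_apply' _ _ _

theorem activeAt_mono (I : Election V C) (t : V → ℝ) (A₀ : Finset V) :
    Monotone (I.activeAt t A₀) := by
  classical
  refine monotone_nat_of_le_succ fun n => ?_
  rw [activeAt_succ]
  exact Finset.subset_union_left

theorem exists_quiesced (I : Election V C) (t : V → ℝ) (A₀ : Finset V) :
    ∃ n, I.activeAt t A₀ n = I.activeAt t A₀ (n + 1) := by
  obtain ⟨n, hn⟩ := WellFoundedGT.monotone_chain_condition
    (⟨I.activeAt t A₀, I.activeAt_mono t A₀⟩ : ℕ →o Finset V)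
  exact ⟨n, hn (n + 1) (Nat.le_succ n)⟩

open scoped Classical in
/-- The set of active nodes when the process has quiesced, i.e. at the first time at which the set
of active nodes does not change in the next round. -/
def active (I : Election V C) (t : V → ℝ) (A₀ : Finset V) : Finset V :=
  I.activeAt t A₀ (Nat.find (I.exists_quiesced t A₀))

/-- The law of the thresholds: independent and uniform on `[0, 1]`. -/
def thresholdLaw (V : Type*) [Fintype V] : Measure (V → ℝ) :=
  Measure.pi fun _ => volume.restrict (Set.Icc (0 : ℝ) 1)

/-- The integer `⌊(α(π_v(c⋆)) / t_v) · ∑_{u ∈ A, (u,v) ∈ E} b_{uv}⌋`. -/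
def rawShift (I : Election V C) (t : V → ℝ) (A₀ : Finset V) (v : V) : ℕ :=
  ⌊I.rate (I.rank v I.target) / t v * I.influence (I.active t A₀) v⌋₊

/-! ### Constructive control: only the score of the target -/

/-- The final position of the target in the list of `v` when it moves up:
`π_v(c⋆) - min (π_v(c⋆) - 1, rawShift)` with positions counted from `1`. -/
def upPos (I : Election V C) (t : V → ℝ) (A₀ : Finset V) (v : V) : Fin (Fintype.card C) :=
  ⟨(I.rank v I.target : ℕ) - min (I.rank v I.target : ℕ) (I.rawShift t A₀ v),
    (Nat.sub_le _ _).trans_lt (I.rank v I.target).isLt⟩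

/-- The constructive score `F(A₀)`: the expected final score of the target when it moves up. -/
def constructiveScore (I : Election V C) (A₀ : Finset V) : ℝ :=
  ∫ t, ∑ v, (I.scoring (I.upPos t A₀ v) : ℝ) ∂thresholdLaw V

/-! ### Destructive control -/

/-- The final position of the target in the list of `v` when it moves down:
`π_v(c⋆) + min (m - π_v(c⋆), rawShift)` with positions counted from `1`. -/
def downPos (I : Election V C) (t : V → ℝ) (A₀ : Finset V) (v : V) : Fin (Fintype.card C) :=
  ⟨(I.rank v I.target : ℕ) +
      min (Fintype.card C - 1 - (I.rank v I.target : ℕ)) (I.rawShift t A₀ v), by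
    have h := (I.rank v I.target).isLt
    omega⟩

open scoped Classical in
/-- The final list of `v` when the target moves down: the candidates that the target passes move
one position up, and all the others stay. -/
def downRank (I : Election V C) (t : V → ℝ) (A₀ : Finset V) (v : V) (c : C) :
    Fin (Fintype.card C) :=
  if c = I.target then I.downPos t A₀ v
  else if I.rank v I.target < I.rank v c ∧ I.rank v c ≤ I.downPos t A₀ v then
    ⟨(I.rank v c : ℕ) - 1, (Nat.sub_le _ _).trans_lt (I.rank v c).isLt⟩
  else I.rank v c

/-- The score of candidate `c` when `pos v c` is the position of `c` in the list of `v`. -/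
def score (I : Election V C) (pos : V → C → Fin (Fintype.card C)) (c : C) : ℕ :=
  ∑ v, I.scoring (pos v c)

open scoped Classical in
/-- The margin of the most voted opponent over the target. (If there is no opponent, the score of
the most voted opponent is read as `0`.) -/
def margin (I : Election V C) (pos : V → C → Fin (Fintype.card C)) : ℝ :=
  (((Finset.univ.erase I.target).sup (I.score pos) : ℕ) : ℝ) - (I.score pos I.target : ℝ)

/-- The objective of destructive control, `E[μ(A₀) - μ(∅)]`, where `μ(∅)` is the margin with the
initial lists and `μ(A₀)` is the margin with the final lists. -/
def destructiveMoV (I : Election V C) (A₀ : Finset V) : ℝ :=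
  ∫ t, (I.margin (I.downRank t A₀) - I.margin (fun v c => I.rank v c)) ∂thresholdLaw V

/-! ### The expectations above are those of integrable random variables -/

instance : IsProbabilityMeasure (thresholdLaw V) := by
  have : IsProbabilityMeasure ((volume : Measure ℝ).restrict (Set.Icc (0 : ℝ) 1)) :=
    ⟨by simp⟩
  unfold thresholdLaw
  infer_instance

open scoped Classical in
theorem measurable_influence (I : Election V C) {A : (V → ℝ) → Finset V}
    (hA : ∀ u, MeasurableSet {t | u ∈ A t}) (v : V) :
    Measurable fun t => I.influence (A t) v := by
  have h : (fun t => I.influence (A t) v) =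
      fun t => ∑ u, if u ∈ A t then (if I.graph.Adj u v then I.weight u v else 0) else 0 := by
    funext t
    simp [influence, Finset.sum_filter, Finset.sum_ite_mem]
  rw [h]
  exact Finset.measurable_sum _ fun u _ =>
    Measurable.ite (hA u) measurable_const measurable_const

theorem measurableSet_mem_activeAt (I : Election V C) (A₀ : Finset V) (n : ℕ) (v : V) :
    MeasurableSet {t | v ∈ I.activeAt t A₀ n} := by
  classical
  induction n generalizing v with
  | zero => exact MeasurableSet.const (v ∈ A₀)
  | succ n ih =>
    have h : {t | v ∈ I.activeAt t A₀ (n + 1)} = {t | v ∈ I.activeAt t A₀ n} ∪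
        {t | t v ≤ I.influence (I.activeAt t A₀ n) v} := by
      ext t
      simp [activeAt_succ, ltmStep]
    rw [h]
    exact (ih v).union
      (measurableSet_le (measurable_pi_apply v) (I.measurable_influence ih v))

theorem mem_active_iff (I : Election V C) (t : V → ℝ) (A₀ : Finset V) (v : V) :
    v ∈ I.active t A₀ ↔ ∃ n, v ∈ I.activeAt t A₀ n := by
  classical
  refine ⟨fun h => ⟨_, h⟩, fun ⟨n, hn⟩ => ?_⟩
  have key : ∀ k, I.activeAt t A₀ (Nat.find (I.exists_quiesced t A₀) + k) = I.active t A₀ := by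
    intro k
    induction k with
    | zero => rfl
    | succ k ih =>
      rw [← add_assoc, activeAt_succ, ih, active, ← activeAt_succ]
      exact (Nat.find_spec (I.exists_quiesced t A₀)).symm
  rw [← key n]
  exact I.activeAt_mono t A₀ (Nat.le_add_left _ _) hn

theorem measurable_rawShift (I : Election V C) (A₀ : Finset V) (v : V) :
    Measurable fun t => I.rawShift t A₀ v := by
  have hA : ∀ u, MeasurableSet {t | u ∈ I.active t A₀} := fun u => by
    simp only [mem_active_iff, Set.ofPred_exists]
    exact MeasurableSet.iUnion fun n => I.measurableSet_mem_activeAt A₀ n u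
  exact Nat.measurable_floor.comp
    ((measurable_const.div (measurable_pi_apply v)).mul (I.measurable_influence hA v))

/-- Every bounded function of the shifts is integrable. -/
theorem integrable_of_rawShift (I : Election V C) (A₀ : Finset V) (g : (V → ℕ) → ℝ)
    (hg : (Set.range g).Finite) :
    Integrable (fun t => g fun v => I.rawShift t A₀ v) (thresholdLaw V) := by
  obtain ⟨b, hb⟩ := (hg.image fun x => ‖x‖).bddAbove
  exact Integrable.of_bound
    ((Measurable.of_discrete (f := g)).comp
      (measurable_pi_lambda _ fun v => I.measurable_rawShift A₀ v)).aestronglyMeasurable b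
    (Filter.Eventually.of_forall fun t => hb ⟨_, ⟨_, rfl⟩, rfl⟩)

theorem integrable_constructiveScore (I : Election V C) (A₀ : Finset V) :
    Integrable (fun t => ∑ v, (I.scoring (I.upPos t A₀ v) : ℝ)) (thresholdLaw V) := by
  let p : (V → ℕ) → V → Fin (Fintype.card C) := fun s v =>
    ⟨(I.rank v I.target : ℕ) - min (I.rank v I.target : ℕ) (s v),
      (Nat.sub_le _ _).trans_lt (I.rank v I.target).isLt⟩
  refine I.integrable_of_rawShift A₀ (fun s => ∑ v, (I.scoring (p s v) : ℝ)) ?_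
  refine (Set.finite_range fun q : V → Fin (Fintype.card C) =>
    ∑ v, (I.scoring (q v) : ℝ)).subset ?_
  rintro _ ⟨s, rfl⟩
  exact ⟨p s, rfl⟩

open scoped Classical in
theorem integrable_destructiveMoV (I : Election V C) (A₀ : Finset V) :
    Integrable (fun t => I.margin (I.downRank t A₀) - I.margin (fun v c => I.rank v c))
      (thresholdLaw V) := by
  let p : (V → ℕ) → V → Fin (Fintype.card C) := fun s v =>
    ⟨(I.rank v I.target : ℕ) + min (Fintype.card C - 1 - (I.rank v I.target : ℕ)) (s v), by
      have h := (I.rank v I.target).isLt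
      omega⟩
  let G : (V → Fin (Fintype.card C)) → ℝ := fun q =>
    I.margin (fun v c => if c = I.target then q v
      else if I.rank v I.target < I.rank v c ∧ I.rank v c ≤ q v then
        ⟨(I.rank v c : ℕ) - 1, (Nat.sub_le _ _).trans_lt (I.rank v c).isLt⟩
      else I.rank v c) - I.margin (fun v c => I.rank v c)
  refine I.integrable_of_rawShift A₀ (fun s => G (p s)) ?_
  refine (Set.finite_range G).subset ?_
  rintro _ ⟨s, rfl⟩
  exact ⟨p s, rfl⟩

/-- The constructive instance to which destructive control is reduced: all lists are reversed,
`π'_v(c) = m - π_v(c) + 1`, the scoring function is complemented,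
`f'(r) = f_max - f(m - r + 1)`, and the rate at the reversed position is the original rate,
`α'(π'_v(c⋆)) = α(π_v(c⋆))`. -/
def reverse (I : Election V C) : Election V C where
  graph := I.graph
  weight := I.weight
  weight_mem := I.weight_mem
  weight_sum_le := I.weight_sum_le
  rank v := (I.rank v).trans Fin.revPerm
  target := I.target
  rate r := I.rate r.rev
  rate_mem r := I.rate_mem r.rev
  scoring r := Finset.univ.sup I.scoring - I.scoring r.rev
  scoring_antitone := fun _ _ h =>
    Nat.sub_le_sub_left (I.scoring_antitone (Fin.rev_le_rev.mpr h)) _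

end Election

open scoped Classical in
/-- `GreedyRun F n A`: the greedy algorithm on the set function `F` can hold the set `A` after `n`
iterations. Each iteration adds a new node of maximum marginal gain; ties are broken in any way. -/
inductive GreedyRun {V : Type*} (F : Finset V → ℝ) : ℕ → Finset V → Prop
  | start : GreedyRun F 0 ∅
  | step {n : ℕ} {A : Finset V} {v : V} (hA : GreedyRun F n A) (hv : v ∉ A)
      (hmax : ∀ w, w ∉ A → F (insert w A) - F A ≤ F (insert v A) - F A) :
      GreedyRun F (n + 1) (insert v A)

/-- `A` is a possible output of the greedy algorithm with budget `B`: there are `B` iterations, or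
fewer if all nodes have been chosen before. -/
def IsGreedyOutput {V : Type*} [Fintype V] (F : Finset V → ℝ) (B : ℕ) (A : Finset V) : Prop :=
  GreedyRun F (min B (Fintype.card V)) A

end

/-! Write L(A₀) for the expected score that the target loses (`targetLoss`, integrated). The
reversed constructive score is a constant plus L (`reverse_constructiveScore`). In every realization
the margin grows by at least the target's loss, since opponents only rise. It grows by at most twice
that loss, since in each list an opponent gains no more than the target loses there. Hence L ≤
E[MoV_D] ≤ 2L, which costs the factor 1/2. The factor 1 - 1/e is the classical greedy bound, once
the constructive score is known to be monotone and submodular.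

Submodularity is the hard part, because the shift of `v` depends on `t v` both through the division
and through the spread. By telescoping it suffices to treat P(shift of `v` ≥ k) for k ≥ 1
(`isMonoSubmodular_integral_le_rawShift`). Fix the other thresholds, and let X and Y be the final
sets when `v` never fires and when `v` is a seed. Integrating out `t v` gives min(b(X) + [v ∈ X],
(α/k) b(Y)), where b(·) is the weight entering `v` (`integral_le_rawShift_update`).

The other thresholds are then replaced, one node at a time, by a random choice of at most one live
in-edge (`integral_update_threshold`). This preserves the expectation of any function of the pair
(X, Y), because the two activation events of a node are nested. Under live edges, reachability
commutes with unions, so Y = X ∪ D with D independent of the seeds, and the minimum above is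
submodular in X (`isMonoSubmodular_min`). -/

/-! ### Closure of a seed set under monotone activation rules. -/

section Closure

open scoped Classical

variable {V : Type*} [Fintype V]

/-- The least set that contains `S` and every node `u` whose activation rule `ρ u` it satisfies. -/
noncomputable def closureUnder (ρ : V → Finset V → Prop) (S : Finset V) : Finset V :=
  Finset.univ.filter fun v => ∀ X, S ⊆ X → (∀ u, ρ u X → u ∈ X) → v ∈ X

theorem subset_closureUnder (ρ : V → Finset V → Prop) (S : Finset V) :
    S ⊆ closureUnder ρ S := fun v hv => by
  simp only [closureUnder, Finset.mem_filter, Finset.mem_univ, true_and]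
  exact fun X hX _ => hX hv

theorem closureUnder_subset {ρ : V → Finset V → Prop} {S X : Finset V} (hS : S ⊆ X)
    (hX : ∀ u, ρ u X → u ∈ X) : closureUnder ρ S ⊆ X := fun v hv => by
  simp only [closureUnder, Finset.mem_filter, Finset.mem_univ, true_and] at hv
  exact hv X hS hX

theorem mem_closureUnder_of_rule {ρ : V → Finset V → Prop} (hρ : ∀ u, Monotone (ρ u))
    {S : Finset V} {u : V} (h : ρ u (closureUnder ρ S)) : u ∈ closureUnder ρ S := by
  simp only [closureUnder, Finset.mem_filter, Finset.mem_univ, true_and]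
  exact fun X hS hX => hX u (hρ u (closureUnder_subset hS hX) h)

theorem closureUnder_mono {ρ : V → Finset V → Prop} (hρ : ∀ u, Monotone (ρ u)) :
    Monotone (closureUnder ρ) := fun _ T h =>
  closureUnder_subset (h.trans (subset_closureUnder ρ T)) fun _ => mem_closureUnder_of_rule hρ

/-- Additivity `hadd` holds for live-edge rules, which look at a single in-neighbour, but fails in
general for threshold rules. This is why thresholds are later traded for live edges. -/
theorem closureUnder_union {ρ : V → Finset V → Prop} (hρ : ∀ u, Monotone (ρ u))
    (hadd : ∀ u X Y, ρ u (X ∪ Y) → ρ u X ∨ ρ u Y) (S T : Finset V) :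
    closureUnder ρ (S ∪ T) = closureUnder ρ S ∪ closureUnder ρ T := by
  apply Finset.Subset.antisymm
  · refine closureUnder_subset
      (Finset.union_subset_union (subset_closureUnder ρ S) (subset_closureUnder ρ T)) ?_
    intro u hu
    rcases hadd u _ _ hu with h | h
    · exact Finset.mem_union_left _ (mem_closureUnder_of_rule hρ h)
    · exact Finset.mem_union_right _ (mem_closureUnder_of_rule hρ h)
  · exact Finset.union_subset (closureUnder_mono hρ Finset.subset_union_left)
      (closureUnder_mono hρ Finset.subset_union_right)

theorem monotone_update_rule {V : Type*} {ρ : V → Finset V → Prop} (hρ : ∀ u, Monotone (ρ u)) (v : V)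
    {r : Finset V → Prop} (hr : Monotone r) (u : V) : Monotone (Function.update ρ v r u) := by
  by_cases h : u = v
  · subst h; simpa using hr
  · simpa [h] using hρ u

/-- The rule of `v` matters only at the set reached when `v` is not activated. -/
theorem closureUnder_update {ρ : V → Finset V → Prop} (hρ : ∀ u, Monotone (ρ u)) (v : V)
    {r : Finset V → Prop} (hr : Monotone r) (S : Finset V) :
    closureUnder (Function.update ρ v r) S =
      if v ∈ S ∨ r (closureUnder (Function.update ρ v fun _ => False) S) then
        closureUnder (Function.update ρ v fun _ => False) (insert v S)
      else closureUnder (Function.update ρ v fun _ => False) S := by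
  have h0 := monotone_update_rule hρ v (r := fun _ => False) monotone_const
  have h1 := monotone_update_rule hρ v hr
  have hle : ∀ T, closureUnder (Function.update ρ v fun _ => False) T ⊆
      closureUnder (Function.update ρ v r) T := by
    intro T
    refine closureUnder_subset (subset_closureUnder _ T) fun u hu => ?_
    by_cases h : u = v
    · subst h; simp at hu
    · refine mem_closureUnder_of_rule h1 ?_
      simpa [h] using hu
  -- Until `v` is active its rule has no effect, so it is first satisfied, if ever, by the set
  -- reached with `v` suppressed. From then on `v` acts as a seed.
  split_ifs with h
  · apply Finset.Subset.antisymm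
    · refine closureUnder_subset ((Finset.subset_insert v S).trans (subset_closureUnder _ _)) ?_
      intro u hu
      by_cases huv : u = v
      · subst huv
        exact subset_closureUnder _ _ (Finset.mem_insert_self _ _)
      · refine mem_closureUnder_of_rule h0 ?_
        simpa [huv] using hu
    · refine (hle _).trans (closureUnder_subset ?_ fun _ => mem_closureUnder_of_rule h1)
      refine Finset.insert_subset ?_ (subset_closureUnder _ _)
      rcases h with h | h
      · exact subset_closureUnder _ _ h
      · refine mem_closureUnder_of_rule h1 ?_
        simpa using hr (hle S) h
  · apply Finset.Subset.antisymm _ (hle S)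
    refine closureUnder_subset (subset_closureUnder _ _) fun u hu => ?_
    by_cases huv : u = v
    · subst huv
      simp only [Function.update_self] at hu
      exact absurd (Or.inr hu) h
    · refine mem_closureUnder_of_rule h0 ?_
      simpa [huv] using hu

theorem mem_closureUnder_update_false {ρ : V → Finset V → Prop} (hρ : ∀ u, Monotone (ρ u)) (v : V)
    (S : Finset V) : v ∈ closureUnder (Function.update ρ v fun _ => False) S ↔ v ∈ S := by
  refine ⟨fun h => ?_, fun h => subset_closureUnder _ _ h⟩
  by_contra hv
  have h0 := monotone_update_rule hρ v (r := fun _ => False) monotone_const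
  have : closureUnder (Function.update ρ v fun _ => False) S ⊆
      (closureUnder (Function.update ρ v fun _ => False) S).erase v := by
    refine closureUnder_subset ?_ ?_
    · intro u hu
      refine Finset.mem_erase.2 ⟨?_, subset_closureUnder _ _ hu⟩
      rintro rfl; exact hv hu
    · intro u hu
      have huv : u ≠ v := by rintro rfl; simp at hu
      exact Finset.mem_erase.2 ⟨huv, mem_closureUnder_of_rule h0
        (h0 u (Finset.erase_subset _ _) hu)⟩
  exact Finset.notMem_erase v _ (this h)

end Closure

/-! ### Monotone submodular set functions. -/

section Submodular

open scoped Classical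

variable {V : Type*}

/-- Monotone submodular set functions. -/
structure IsMonoSubmodular (F : Finset V → ℝ) : Prop where
  mono : Monotone F
  submodular : ∀ S T, F (S ∪ T) + F (S ∩ T) ≤ F S + F T

theorem IsMonoSubmodular.const (a : ℝ) : IsMonoSubmodular fun _ : Finset V => a :=
  ⟨monotone_const, fun _ _ => le_rfl⟩

theorem IsMonoSubmodular.add {F G : Finset V → ℝ} (hF : IsMonoSubmodular F)
    (hG : IsMonoSubmodular G) : IsMonoSubmodular fun S => F S + G S :=
  ⟨hF.mono.add hG.mono, fun S T => by
    have := hF.submodular S T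
    have := hG.submodular S T
    linarith⟩

theorem IsMonoSubmodular.const_mul {F : Finset V → ℝ} (hF : IsMonoSubmodular F) {a : ℝ}
    (ha : 0 ≤ a) : IsMonoSubmodular fun S => a * F S :=
  ⟨hF.mono.const_mul ha, fun S T => by
    have := mul_le_mul_of_nonneg_left (hF.submodular S T) ha
    linarith⟩

theorem IsMonoSubmodular.sum {ι : Type*} (s : Finset ι) {F : ι → Finset V → ℝ}
    (hF : ∀ i ∈ s, IsMonoSubmodular (F i)) : IsMonoSubmodular fun S => ∑ i ∈ s, F i S := by
  induction s using Finset.induction_on with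
  | empty => simpa using IsMonoSubmodular.const 0
  | insert i s hi ih =>
    simp only [Finset.sum_insert hi]
    exact (hF i (Finset.mem_insert_self _ _)).add
      (ih fun j hj => hF j (Finset.mem_insert_of_mem hj))

/-- `R` need not preserve intersections: R(S ∩ T) ⊆ R S ∩ R T is enough because `F` is monotone. -/
theorem IsMonoSubmodular.comp {F : Finset V → ℝ} (hF : IsMonoSubmodular F)
    {R : Finset V → Finset V} (hR : Monotone R) (hU : ∀ S T, R (S ∪ T) = R S ∪ R T) :
    IsMonoSubmodular fun S => F (R S) :=
  ⟨hF.mono.comp hR, fun S T => by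
    have h1 := hF.submodular (R S) (R T)
    have h2 := hF.mono (Finset.subset_inter (hR (Finset.inter_subset_left (s₁ := S) (s₂ := T)))
      (hR (Finset.inter_subset_right (s₁ := S) (s₂ := T))))
    simp only [hU] at *
    linarith⟩

/-- Truncation at `K` is concave, and `c`, `d` lie between `b` and `a` with the same sum. -/
theorem min_add_min_le_of_modular {a b c d : ℝ} (K : ℝ) (h : a + b = c + d) (hc : b ≤ c)
    (hd : b ≤ d) : min a K + min b K ≤ min c K + min d K := by
  rcases min_cases a K with ⟨h1, _⟩ | ⟨h1, _⟩ <;> rcases min_cases b K with ⟨h2, _⟩ | ⟨h2, _⟩ <;>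
  rcases min_cases c K with ⟨h3, _⟩ | ⟨h3, _⟩ <;> rcases min_cases d K with ⟨h4, _⟩ | ⟨h4, _⟩ <;>
  rw [h1, h2, h3, h4] <;> linarith

/-- The minimum of the additive function `β` and of `γ` on the union with `D` is submodular when
`γ ≤ β` pointwise. -/
theorem isMonoSubmodular_min {β γ : V → ℝ} (hγ : ∀ u, 0 ≤ γ u) (hβ : ∀ u, γ u ≤ β u)
    (D : Finset V) :
    IsMonoSubmodular fun X => min (∑ u ∈ X, β u) (∑ u ∈ X ∪ D, γ u) := by
  constructor
  · intro X Y h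
    exact min_le_min (Finset.sum_le_sum_of_subset_of_nonneg h fun u _ _ => (hγ u).trans (hβ u))
      (Finset.sum_le_sum_of_subset_of_nonneg (Finset.union_subset_union_left h)
        fun u _ _ => hγ u)
  -- Pulling the additive part γ(X \ D) out of the minimum leaves a nonnegative additive function
  -- truncated at the constant γ(D).
  · have key : ∀ X : Finset V, min (∑ u ∈ X, β u) (∑ u ∈ X ∪ D, γ u) =
        (∑ u ∈ X, if u ∈ D then 0 else γ u) +
          min (∑ u ∈ X, (β u - if u ∈ D then 0 else γ u)) (∑ u ∈ D, γ u) := by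
      intro X
      rw [← min_add_add_left, ← Finset.sum_add_distrib]
      congr 1
      · exact Finset.sum_congr rfl fun u _ => by ring
      · rw [← Finset.sdiff_union_self_eq_union, Finset.sum_union Finset.sdiff_disjoint,
          Finset.sdiff_eq_filter, Finset.sum_filter]
        congr 1
        exact Finset.sum_congr rfl fun u _ => by by_cases h : u ∈ D <;> simp [h]
    have hnn : ∀ u, 0 ≤ β u - if u ∈ D then 0 else γ u := fun u => by
      have := hγ u
      have := hβ u
      split_ifs <;> linarith
    intro S T
    simp only [key]
    have h1 := Finset.sum_union_inter (s₁ := S) (s₂ := T) (f := fun u => if u ∈ D then 0 else γ u)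
    have h2 := min_add_min_le_of_modular (∑ u ∈ D, γ u) (Finset.sum_union_inter (s₁ := S)
      (s₂ := T) (f := fun u => β u - if u ∈ D then 0 else γ u))
      (Finset.sum_le_sum_of_subset_of_nonneg Finset.inter_subset_left fun u _ _ => hnn u)
      (Finset.sum_le_sum_of_subset_of_nonneg Finset.inter_subset_right fun u _ _ => hnn u)
    linarith

theorem IsMonoSubmodular.le_add_sum_gain {F : Finset V → ℝ} (hF : IsMonoSubmodular F)
    (A S : Finset V) : F (A ∪ S) ≤ F A + ∑ v ∈ S, (F (insert v A) - F A) := by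
  induction S using Finset.induction_on with
  | empty => simp
  | insert v S hv ih =>
    rw [Finset.sum_insert hv]
    have h := hF.submodular (A ∪ S) (insert v A)
    have h1 : (A ∪ S) ∪ insert v A = A ∪ insert v S := by ext; simp; tauto
    have h2 := hF.mono (show A ≤ (A ∪ S) ∩ insert v A from
      Finset.subset_inter Finset.subset_union_left (Finset.subset_insert _ _))
    rw [h1] at h
    linarith

end Submodular

/-! ### The greedy bound for monotone submodular functions. -/

section Greedy

open scoped Classical

variable {V : Type*}

theorem GreedyRun.card_eq {F : Finset V → ℝ} {n : ℕ} {A : Finset V} (h : GreedyRun F n A) :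
    A.card = n := by
  induction h with
  | start => rfl
  | step _ hv _ ih => rw [Finset.card_insert_of_notMem hv, ih]

theorem exists_greedyRun [Fintype V] (F : Finset V → ℝ) {n : ℕ} (hn : n ≤ Fintype.card V) :
    ∃ A, GreedyRun F n A := by
  induction n with
  | zero => exact ⟨∅, .start⟩
  | succ n ih =>
    obtain ⟨A, hA⟩ := ih (by omega)
    have hne : (Aᶜ).Nonempty := by
      rw [← Finset.card_pos, Finset.card_compl, hA.card_eq]
      omega
    obtain ⟨v, hv, hmax⟩ := Finset.exists_max_image Aᶜ (fun w => F (insert w A)) hne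
    refine ⟨insert v A, hA.step (Finset.mem_compl.1 hv) fun w hw => ?_⟩
    linarith [hmax w (Finset.mem_compl.2 hw)]

/-- The gains of the at most `B` nodes of `S` add up to at least the current gap, so the best gain
closes a 1/B fraction of it. -/
theorem GreedyRun.gap_le {F : Finset V → ℝ} (hF : IsMonoSubmodular F) {B : ℕ} (hB : 0 < B)
    {S : Finset V} (hS : S.card ≤ B) {n : ℕ} {A : Finset V} (h : GreedyRun F n A) :
    F S - F A ≤ (1 - 1 / B) ^ n * (F S - F ∅) := by
  induction h with
  | start => simp
  | @step n A v _ hv hmax ih =>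
    have hB' : (0 : ℝ) < B := by exact_mod_cast hB
    have hgain : 0 ≤ F (insert v A) - F A := sub_nonneg.2 (hF.mono (Finset.subset_insert v A))
    have h1 := (hF.mono (Finset.subset_union_right (s₁ := A) (s₂ := S))).trans
      (hF.le_add_sum_gain A S)
    have h2 : ∑ w ∈ S, (F (insert w A) - F A) ≤ B * (F (insert v A) - F A) := by
      calc ∑ w ∈ S, (F (insert w A) - F A) ≤ S.card • (F (insert v A) - F A) := by
            refine Finset.sum_le_card_nsmul _ _ _ fun w _ => ?_
            by_cases hw : w ∈ A
            · simpa [Finset.insert_eq_of_mem hw] using hF.mono (Finset.subset_insert v A)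
            · exact hmax w hw
        _ ≤ B * (F (insert v A) - F A) := by
            rw [nsmul_eq_mul]
            exact mul_le_mul_of_nonneg_right (by exact_mod_cast hS) hgain
    have h3 : 0 ≤ 1 - 1 / (B : ℝ) := by
      rw [sub_nonneg, div_le_one hB']
      exact_mod_cast hB
    have h4 : (1 / (B : ℝ)) * (F S - F A) ≤ F (insert v A) - F A := by
      rw [one_div, inv_mul_le_iff₀ hB']
      linarith
    have h5 := mul_le_mul_of_nonneg_left ih h3
    rw [pow_succ']
    linarith

theorem IsGreedyOutput.approx [Fintype V] {F : Finset V → ℝ} (hF : IsMonoSubmodular F) {B : ℕ}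
    {A S : Finset V} (h : IsGreedyOutput F B A) (hS : S.card ≤ B) :
    (1 - 1 / Real.exp 1) * (F S - F ∅) ≤ F A - F ∅ := by
  have hS0 : 0 ≤ F S - F ∅ := sub_nonneg.2 (hF.mono (Finset.empty_subset S))
  have hexp : 0 ≤ 1 / Real.exp 1 := by positivity
  unfold IsGreedyOutput at h
  have hcard := h.card_eq
  rcases Nat.eq_zero_or_pos B with rfl | hB
  · obtain rfl : S = ∅ := Finset.card_eq_zero.1 (Nat.le_zero.1 hS)
    have := hF.mono (Finset.empty_subset A)
    simpa using this
  · rcases le_total B (Fintype.card V) with hV | hV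
    · rw [min_eq_left hV] at h
      have h1 := h.gap_le hF hB hS
      have h2 : (1 - 1 / (B : ℝ)) ^ B ≤ 1 / Real.exp 1 := by
        have := Real.one_sub_div_pow_le_exp_neg (n := B) (t := 1) (by exact_mod_cast hB)
        rwa [Real.exp_neg, ← one_div] at this
      have h3 := mul_le_mul_of_nonneg_right h2 hS0
      linarith
    -- With fewer than `B` iterations the power bound is not available, but then every node has been
    -- chosen.
    · rw [min_eq_right hV] at hcard
      have : A = Finset.univ := (Finset.card_eq_iff_eq_univ A).1 hcard
      have h1 : F S ≤ F A := hF.mono (this ▸ Finset.subset_univ S)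
      have h3 := mul_nonneg hexp hS0
      linarith

end Greedy
-- Integrating out a single threshold.
section Thresholds

open scoped Classical

variable {V : Type*} [Fintype V]

/-- Resampling one coordinate of a product law does not change the law; with Fubini, this isolates
`t v`. -/
theorem measurePreserving_update_threshold (v : V) :
    MeasurePreserving (fun p : (V → ℝ) × ℝ => Function.update p.1 v p.2)
      ((Election.thresholdLaw V).prod (volume.restrict (Set.Icc (0 : ℝ) 1)))
      (Election.thresholdLaw V) := by
  have hm : Measurable fun p : (V → ℝ) × ℝ => Function.update p.1 v p.2 := by
    refine measurable_pi_lambda _ fun u => ?_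
    by_cases h : u = v
    · subst h; simpa using measurable_snd
    · simp only [Function.update_of_ne h]
      exact (measurable_pi_apply u).comp measurable_fst
  refine ⟨hm, ?_⟩
  symm
  refine Measure.pi_eq fun s hs => ?_
  rw [Measure.map_apply hm (MeasurableSet.univ_pi hs)]
  have hpre : (fun p : (V → ℝ) × ℝ => Function.update p.1 v p.2) ⁻¹' Set.univ.pi s =
      (Set.univ.pi (Function.update s v Set.univ)) ×ˢ s v := by
    ext ⟨t, x⟩
    simp only [Set.mem_preimage, Set.mem_univ_pi, Set.mem_prod]
    constructor
    · refine fun h => ⟨fun u => ?_, by simpa using h v⟩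
      by_cases huv : u = v
      · subst huv; simp
      · simpa [huv] using h u
    · rintro ⟨h, hx⟩ u
      by_cases huv : u = v
      · subst huv; simpa using hx
      · simpa [huv] using h u
  rw [hpre, Measure.prod_prod, Election.thresholdLaw, Measure.pi_pi,
    ← Finset.mul_prod_erase _ _ (Finset.mem_univ v),
    ← Finset.mul_prod_erase _ (fun i => (volume.restrict (Set.Icc (0 : ℝ) 1)) (s i))
      (Finset.mem_univ v), mul_comm]
  have hone : (volume.restrict (Set.Icc (0 : ℝ) 1)) Set.univ = 1 := by simp
  rw [Function.update_self, hone, one_mul]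
  congr 1
  refine Finset.prod_congr rfl fun u hu => ?_
  rw [Function.update_of_ne (Finset.ne_of_mem_erase hu)]

theorem integral_thresholdLaw_update (v : V) {g : (V → ℝ) → ℝ}
    (hg : Integrable g (Election.thresholdLaw V)) :
    ∫ t, g t ∂Election.thresholdLaw V =
      ∫ t, (∫ x in Set.Icc (0 : ℝ) 1, g (Function.update t v x)) ∂Election.thresholdLaw V := by
  have hp := measurePreserving_update_threshold v
  rw [← hp.map_eq] at hg
  have h := integral_map hp.aemeasurable hg.aestronglyMeasurable
  rw [hp.map_eq] at h
  rw [h, integral_prod]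
  exact hg.comp_aemeasurable hp.aemeasurable

theorem integral_ite_le {a : ℝ} (h0 : 0 ≤ a) (h1 : a ≤ 1) :
    ∫ x in Set.Icc (0 : ℝ) 1, (if x ≤ a then (1 : ℝ) else 0) = a := by
  have h : (fun x : ℝ => if x ≤ a then (1 : ℝ) else 0) = (Set.Iic a).indicator 1 := by
    ext x; simp [Set.indicator_apply]
  rw [h, integral_indicator_one measurableSet_Iic, measureReal_restrict_apply measurableSet_Iic]
  have h2 : Set.Iic a ∩ Set.Icc (0 : ℝ) 1 = Set.Icc 0 a := by
    ext x; simp only [Set.mem_inter_iff, Set.mem_Iic, Set.mem_Icc]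
    exact ⟨fun h => ⟨h.2.1, h.1⟩, fun h => ⟨h.2, h.1, h.2.trans h1⟩⟩
  rw [h2]; simp [measureReal_def, h0]

theorem integrable_ite_le (a : ℝ) :
    Integrable (fun x : ℝ => if x ≤ a then (1 : ℝ) else 0) (volume.restrict (Set.Icc (0 : ℝ) 1)) :=
  Integrable.of_bound (Measurable.ite measurableSet_Iic measurable_const
    measurable_const).aestronglyMeasurable 1
    (Filter.Eventually.of_forall fun x => by split_ifs <;> simp)

/-- Nestedness excludes one of the four truth patterns, so `Ψ` is affine in the two indicators. Its
mean then depends only on the two probabilities, not on how the events arise. -/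
theorem apply_of_imp (Ψ : Prop → Prop → ℝ) {p q : Prop} (h : p → q) :
    Ψ p q = Ψ False False + (Ψ False True - Ψ False False) * (if q then 1 else 0) +
      (Ψ True True - Ψ False True) * (if p then 1 else 0) := by
  by_cases hp : p <;> by_cases hq : q
  · simp [hp, hq]
  · exact absurd (h hp) hq
  · simp [hp, hq]
  · simp [hp, hq]

theorem integral_apply_le (Ψ : Prop → Prop → ℝ) {a b : ℝ} (h0 : 0 ≤ a) (hab : a ≤ b)
    (h1 : b ≤ 1) :
    ∫ x in Set.Icc (0 : ℝ) 1, Ψ (x ≤ a) (x ≤ b) =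
      Ψ False False + (Ψ False True - Ψ False False) * b + (Ψ True True - Ψ False True) * a := by
  have h : (fun x : ℝ => Ψ (x ≤ a) (x ≤ b)) = fun x => (Ψ False False +
      (Ψ False True - Ψ False False) * (if x ≤ b then 1 else 0)) +
      (Ψ True True - Ψ False True) * (if x ≤ a then 1 else 0) :=
    funext fun x => apply_of_imp Ψ fun hx => hx.trans hab
  rw [h, integral_add, integral_add, integral_const_mul, integral_const_mul,
    integral_ite_le h0 (hab.trans h1), integral_ite_le (h0.trans hab) h1]
  · simp
  · exact integrable_const _
  · exact (integrable_ite_le b).const_mul _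
  · exact (integrable_const _).add ((integrable_ite_le b).const_mul _)
  · exact (integrable_ite_le a).const_mul _

/-- A function of finitely many measurable events is integrable. -/
theorem integrable_of_measurableSet {Ω ι κ : Type*} [MeasurableSpace Ω] [Finite ι] [Finite κ]
    (μ : Measure Ω) [IsFiniteMeasure μ] (g : (ι → κ → Prop) → ℝ) {ρ : Ω → ι → κ → Prop}
    (hρ : ∀ i k, MeasurableSet {t | ρ t i k}) : Integrable (fun t => g (ρ t)) μ := by
  obtain ⟨b, hb⟩ := (Set.finite_range fun x => ‖g x‖).bddAbove
  have hm : Measurable ρ := measurable_pi_lambda _ fun i => measurable_pi_lambda _ fun k =>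
    measurableSet_setOfPred.1 (hρ i k)
  exact Integrable.of_bound ((Measurable.of_discrete (f := g)).comp hm).aestronglyMeasurable b
    (Filter.Eventually.of_forall fun t => hb ⟨_, rfl⟩)

end Thresholds

/-! ### From thresholds to live edges. -/

namespace Election

section Diffusion

open scoped Classical

variable {V C : Type*} [Fintype V] [Fintype C]

theorem influence_eq_sum (I : Election V C) (A : Finset V) (v : V) :
    I.influence A v = ∑ u ∈ A, if I.graph.Adj u v then I.weight u v else 0 := by
  rw [influence, Finset.sum_filter]

theorem edgeWeight_nonneg (I : Election V C) (u v : V) :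
    0 ≤ if I.graph.Adj u v then I.weight u v else 0 := by
  split_ifs with h
  · exact (I.weight_mem u v h).1
  · exact le_rfl

theorem influence_mono (I : Election V C) (v : V) : Monotone fun A => I.influence A v :=
  fun A B h => by
    simp only [influence_eq_sum]
    exact Finset.sum_le_sum_of_subset_of_nonneg h fun u _ _ => I.edgeWeight_nonneg u v

theorem influence_nonneg (I : Election V C) (A : Finset V) (v : V) : 0 ≤ I.influence A v := by
  rw [influence_eq_sum]
  exact Finset.sum_nonneg fun u _ => I.edgeWeight_nonneg u v

theorem influence_le_one (I : Election V C) (A : Finset V) (v : V) : I.influence A v ≤ 1 :=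
  (I.influence_mono v (Finset.subset_univ A)).trans (I.weight_sum_le v)

theorem influence_eq_sum_univ (I : Election V C) (A : Finset V) (v : V) :
    I.influence A v =
      ∑ u, (if I.graph.Adj u v then I.weight u v else 0) * (if u ∈ A then 1 else 0) := by
  simp [influence_eq_sum]

/-- The activation rules of the Linear Threshold Model. -/
def thresholdRule (I : Election V C) (t : V → ℝ) (v : V) (A : Finset V) : Prop :=
  t v ≤ I.influence A v

theorem monotone_thresholdRule (I : Election V C) (t : V → ℝ) (v : V) :
    Monotone (I.thresholdRule t v) := fun _ _ h hA => le_trans hA (I.influence_mono v h)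

theorem active_eq_closureUnder (I : Election V C) (t : V → ℝ) (S : Finset V) :
    I.active t S = closureUnder (I.thresholdRule t) S := by
  apply Finset.Subset.antisymm
  · intro v hv
    obtain ⟨n, hn⟩ := (I.mem_active_iff t S v).1 hv
    clear hv
    induction n generalizing v with
    | zero => exact subset_closureUnder _ _ hn
    | succ n ih =>
      rw [activeAt_succ, ltmStep, Finset.mem_union, Finset.mem_filter] at hn
      rcases hn with hn | hn
      · exact ih hn
      · exact mem_closureUnder_of_rule (I.monotone_thresholdRule t)
          (I.monotone_thresholdRule t v (fun u hu => ih hu) hn.2)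
  · refine closureUnder_subset (fun v hv => (I.mem_active_iff t S v).2 ⟨0, hv⟩) fun v hv => ?_
    refine (I.mem_active_iff t S v).2 ⟨Nat.find (I.exists_quiesced t S) + 1, ?_⟩
    rw [activeAt_succ, ltmStep, Finset.mem_union, Finset.mem_filter]
    exact Or.inr ⟨Finset.mem_univ v, hv⟩

/-- Averaging over the threshold of `v` amounts to averaging over at most one in-neighbour of `v`
that activates `v`. -/
theorem integral_update_threshold (I : Election V C) {ρ : V → Finset V → Prop}
    (hρ : ∀ u, Monotone (ρ u)) (v : V) (ψ : Finset V → Finset V → ℝ) {S T : Finset V}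
    (hST : S ⊆ T) :
    ∫ x in Set.Icc (0 : ℝ) 1,
      ψ (closureUnder (Function.update ρ v fun A => x ≤ I.influence A v) S)
        (closureUnder (Function.update ρ v fun A => x ≤ I.influence A v) T) =
    ∑ u, (if I.graph.Adj u v then I.weight u v else 0) *
      ψ (closureUnder (Function.update ρ v fun A => u ∈ A) S)
        (closureUnder (Function.update ρ v fun A => u ∈ A) T) +
    (1 - I.influence Finset.univ v) *
      ψ (closureUnder (Function.update ρ v fun _ => False) S)
        (closureUnder (Function.update ρ v fun _ => False) T) := by
  set ρ₀ := Function.update ρ v fun _ => False with hρ₀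
  have h0 : ∀ u, Monotone (ρ₀ u) := monotone_update_rule hρ v monotone_const
  -- By `closureUnder_update`, the rule of `v` enters only through its truth values at the two sets
  -- reached with `v` suppressed. These sets are nested, and a random in-neighbour lies in each of
  -- them with the same probability with which the threshold is met there.
  let Ψ : Prop → Prop → ℝ := fun p q =>
    ψ (if v ∈ S ∨ p then closureUnder ρ₀ (insert v S) else closureUnder ρ₀ S)
      (if v ∈ T ∨ q then closureUnder ρ₀ (insert v T) else closureUnder ρ₀ T)
  have key : ∀ r : Finset V → Prop, Monotone r →
      ψ (closureUnder (Function.update ρ v r) S) (closureUnder (Function.update ρ v r) T) =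
        Ψ (r (closureUnder ρ₀ S)) (r (closureUnder ρ₀ T)) := fun r hr => by
    rw [closureUnder_update hρ v hr S, closureUnder_update hρ v hr T]
  have hsub := closureUnder_mono h0 hST
  have hx : ∀ x : ℝ, Monotone fun A => x ≤ I.influence A v :=
    fun x A B h hA => le_trans hA (I.influence_mono v h)
  have hu : ∀ u : V, Monotone fun A : Finset V => u ∈ A := fun u A B h hA => h hA
  have hf : ψ (closureUnder ρ₀ S) (closureUnder ρ₀ T) = Ψ False False :=
    key (fun _ => False) monotone_const
  simp only [fun x => key _ (hx x), fun u => key _ (hu u), hf]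
  rw [integral_apply_le Ψ (I.influence_nonneg _ _) (I.influence_mono v hsub)
    (I.influence_le_one _ _)]
  beta_reduce
  rw [influence_eq_sum_univ I (closureUnder ρ₀ S), influence_eq_sum_univ I (closureUnder ρ₀ T), influence_eq_sum I Finset.univ]
  have hsum : ∀ u, (if I.graph.Adj u v then I.weight u v else 0) *
      Ψ (u ∈ closureUnder ρ₀ S) (u ∈ closureUnder ρ₀ T) =
      (if I.graph.Adj u v then I.weight u v else 0) * Ψ False False +
      (Ψ False True - Ψ False False) * ((if I.graph.Adj u v then I.weight u v else 0) *
        (if u ∈ closureUnder ρ₀ T then 1 else 0)) +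
      (Ψ True True - Ψ False True) * ((if I.graph.Adj u v then I.weight u v else 0) *
        (if u ∈ closureUnder ρ₀ S then 1 else 0)) := fun u => by
    rw [apply_of_imp Ψ (fun h => hsub h)]
    ring_nf
  simp only [hsum, Finset.sum_add_distrib, ← Finset.mul_sum, ← Finset.sum_mul]
  ring_nf

/-- The rules in which the nodes of `Q` have thresholds `t` and the other nodes have rules `σ`. -/
def mixedRule (I : Election V C) (Q : Finset V) (σ : V → Finset V → Prop) (t : V → ℝ) (v : V)
    (A : Finset V) : Prop :=
  if v ∈ Q then t v ≤ I.influence A v else σ v A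

theorem monotone_mixedRule (I : Election V C) (Q : Finset V) {σ : V → Finset V → Prop}
    (hσ : ∀ u, Monotone (σ u)) (t : V → ℝ) (v : V) : Monotone (I.mixedRule Q σ t v) := by
  intro A B h
  unfold mixedRule
  split_ifs
  · exact fun hA => le_trans hA (I.influence_mono v h)
  · exact hσ v h

theorem mixedRule_insert (I : Election V C) (Q : Finset V) (v : V)
    (σ : V → Finset V → Prop) (t : V → ℝ) (x : ℝ) :
    I.mixedRule (insert v Q) σ (Function.update t v x) =
      Function.update (I.mixedRule Q σ t) v fun A => x ≤ I.influence A v := by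
  funext u A
  by_cases h : u = v
  · subst h; simp [mixedRule]
  · simp [mixedRule, h]

theorem update_mixedRule (I : Election V C) {Q : Finset V} {v : V} (hv : v ∉ Q)
    (σ : V → Finset V → Prop) (t : V → ℝ) (r : Finset V → Prop) :
    Function.update (I.mixedRule Q σ t) v r = I.mixedRule Q (Function.update σ v r) t := by
  funext u A
  by_cases h : u = v
  · subst h; simp [mixedRule, hv]
  · simp [mixedRule, h]

theorem integrable_mixedRule (I : Election V C) (Q : Finset V) (σ : V → Finset V → Prop)
    (g : (V → Finset V → Prop) → ℝ) :
    Integrable (fun t => g (I.mixedRule Q σ t)) (thresholdLaw V) := by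
  refine integrable_of_measurableSet _ g fun v A => ?_
  by_cases h : v ∈ Q
  · simpa [mixedRule, h] using measurableSet_le (measurable_pi_apply v) measurable_const
  · simp [mixedRule, h]

/-- Submodularity of the expected value of a submodular function of the active sets. -/
theorem isMonoSubmodular_integral_mixedRule (I : Election V C) (w : V)
    (ψ : Finset V → Finset V → ℝ) (hψ : ∀ D, IsMonoSubmodular fun X => ψ X (X ∪ D))
    (Q : Finset V) (σ : V → Finset V → Prop) (hσ : ∀ u, Monotone (σ u))
    (hadd : ∀ u X Y, σ u (X ∪ Y) → σ u X ∨ σ u Y) :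
    IsMonoSubmodular fun S => ∫ t, ψ (closureUnder (I.mixedRule Q σ t) S)
      (closureUnder (I.mixedRule Q σ t) (insert w S)) ∂thresholdLaw V := by
  induction Q using Finset.induction_on generalizing σ with
  | empty =>
    have h : ∀ t, I.mixedRule ∅ σ t = σ := fun t => by funext u A; simp [mixedRule]
    -- With no thresholds left all rules are additive, so seeding `w` adds a fixed set D.
    have hins : ∀ S, closureUnder σ (insert w S) = closureUnder σ S ∪ closureUnder σ {w} :=
      fun S => by rw [← closureUnder_union hσ hadd, Finset.union_comm, Finset.insert_eq]
    simp only [h, hins, integral_const, probReal_univ, one_smul]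
    exact (hψ (closureUnder σ {w})).comp (closureUnder_mono hσ) (closureUnder_union hσ hadd)
  | insert v Q hv ih =>
    have hstep : (fun S => ∫ t, ψ (closureUnder (I.mixedRule (insert v Q) σ t) S)
        (closureUnder (I.mixedRule (insert v Q) σ t) (insert w S)) ∂thresholdLaw V) =
        fun S => ∑ u, (if I.graph.Adj u v then I.weight u v else 0) *
          (∫ t, ψ (closureUnder (I.mixedRule Q (Function.update σ v fun A => u ∈ A) t) S)
            (closureUnder (I.mixedRule Q (Function.update σ v fun A => u ∈ A) t) (insert w S))
            ∂thresholdLaw V) +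
        (1 - I.influence Finset.univ v) *
          ∫ t, ψ (closureUnder (I.mixedRule Q (Function.update σ v fun _ => False) t) S)
            (closureUnder (I.mixedRule Q (Function.update σ v fun _ => False) t) (insert w S))
            ∂thresholdLaw V := by
      funext S
      have hint : ∀ (Q' : Finset V) (σ' : V → Finset V → Prop), Integrable (fun t =>
          ψ (closureUnder (I.mixedRule Q' σ' t) S)
            (closureUnder (I.mixedRule Q' σ' t) (insert w S))) (thresholdLaw V) :=
        fun Q' σ' => I.integrable_mixedRule Q' σ' fun ρ =>
          ψ (closureUnder ρ S) (closureUnder ρ (insert w S))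
      rw [integral_thresholdLaw_update v (hint _ _)]
      simp only [I.mixedRule_insert Q v]
      rw [integral_congr_ae (Filter.Eventually.of_forall fun t => I.integral_update_threshold
        (I.monotone_mixedRule Q hσ t) v ψ (Finset.subset_insert w S))]
      simp only [I.update_mixedRule hv]
      rw [integral_add, integral_finsetSum]
      · simp only [integral_const_mul]
      · exact fun u _ => (hint _ _).const_mul _
      · exact integrable_finsetSum _ fun u _ => (hint _ _).const_mul _
      · exact (hint _ _).const_mul _
    rw [hstep]
    have hmono : ∀ r : Finset V → Prop, Monotone r → ∀ u, Monotone (Function.update σ v r u) :=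
      fun r hr => monotone_update_rule hσ v hr
    have hadd' : ∀ r : Finset V → Prop, (∀ X Y, r (X ∪ Y) → r X ∨ r Y) →
        ∀ u X Y, Function.update σ v r u (X ∪ Y) →
          Function.update σ v r u X ∨ Function.update σ v r u Y := by
      intro r hr u X Y
      by_cases h : u = v
      · subst h; simpa using hr X Y
      · simpa [h] using hadd u X Y
    -- The mixture has nonnegative coefficients because the weights entering `v` sum to at most 1.
    refine IsMonoSubmodular.add (IsMonoSubmodular.sum _ fun u _ =>
      IsMonoSubmodular.const_mul ?_ (I.edgeWeight_nonneg u v))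
      (IsMonoSubmodular.const_mul ?_ (sub_nonneg.2 (I.influence_le_one _ _)))
    · exact ih _ (hmono _ fun A B h hA => h hA) (hadd' _ fun X Y => Finset.mem_union.1)
    · exact ih _ (hmono _ monotone_const) (hadd' _ fun X Y h => h.elim)

end Diffusion

end Election

/-! ### Submodularity of the constructive score. -/

namespace Election

section Score

open scoped Classical

variable {V C : Type*} [Fintype V] [Fintype C]

theorem thresholdRule_update (I : Election V C) (t : V → ℝ) (v : V) (x : ℝ) :
    I.thresholdRule (Function.update t v x) =
      Function.update (I.mixedRule (Finset.univ.erase v) (fun _ _ => False) t) v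
        fun A => x ≤ I.influence A v := by
  funext u A
  by_cases h : u = v
  · subst h; simp [thresholdRule]
  · simp [thresholdRule, mixedRule, h]

theorem update_mixedRule_erase (I : Election V C) (t : V → ℝ) (v : V) :
    Function.update (I.mixedRule (Finset.univ.erase v) (fun _ _ => False) t) v (fun _ => False) =
      I.mixedRule (Finset.univ.erase v) (fun _ _ => False) t := by
  rw [Function.update_eq_self_iff]
  funext A
  simp [mixedRule]

/-- The probability of a shift by at least `k` given the thresholds of the other nodes. -/
theorem integral_le_rawShift_update (I : Election V C) (t : V → ℝ) (S : Finset V) (v : V) {k : ℕ}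
    (hk : 1 ≤ k) :
    ∫ x in Set.Icc (0 : ℝ) 1, (if k ≤ I.rawShift (Function.update t v x) S v then (1 : ℝ) else 0) =
      min (∑ u ∈ closureUnder (I.mixedRule (Finset.univ.erase v) (fun _ _ => False) t) S,
          ((if I.graph.Adj u v then I.weight u v else 0) + if u = v then 1 else 0))
        (∑ u ∈ closureUnder (I.mixedRule (Finset.univ.erase v) (fun _ _ => False) t) (insert v S),
          I.rate (I.rank v I.target) / k * if I.graph.Adj u v then I.weight u v else 0) := by
  set ρ := I.mixedRule (Finset.univ.erase v) (fun _ _ => False) t with hρdef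
  have hρ : ∀ u, Monotone (ρ u) := I.monotone_mixedRule _ (fun _ => monotone_const) t
  have hmem := mem_closureUnder_update_false hρ v S
  have hcl : ∀ x : ℝ, I.active (Function.update t v x) S =
      if v ∈ S ∨ x ≤ I.influence (closureUnder ρ S) v then closureUnder ρ (insert v S)
      else closureUnder ρ S := fun x => by
    rw [active_eq_closureUnder, thresholdRule_update, ← hρdef, closureUnder_update hρ v
      (fun A B h hA => le_trans hA (I.influence_mono v h)), hρdef, update_mixedRule_erase]
  rw [hρdef, update_mixedRule_erase, ← hρdef] at hmem
  obtain ⟨hα0, hα1⟩ := I.rate_mem (I.rank v I.target)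
  set α := I.rate (I.rank v I.target) with hα
  have hk0 : (0 : ℝ) < k := by exact_mod_cast hk
  have hc0 : 0 ≤ α / k := by positivity
  have hc1 : α / k ≤ 1 := by
    rw [div_le_one hk0]
    exact hα1.trans (by exact_mod_cast hk)
  rw [Finset.sum_add_distrib, ← Finset.mul_sum, ← influence_eq_sum, ← influence_eq_sum,
    Finset.sum_ite_eq']
  set X := closureUnder ρ S
  set Y := closureUnder ρ (insert v S)
  have hX0 := I.influence_nonneg X v
  have hX1 := I.influence_le_one X v
  have hY0 := I.influence_nonneg Y v
  have hY1 := I.influence_le_one Y v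
  have hcY0 : 0 ≤ α / k * I.influence Y v := by positivity
  have hcY1 : α / k * I.influence Y v ≤ 1 := mul_le_one₀ hc1 hY0 hY1
  have hcX : α / k * I.influence X v ≤ I.influence X v := mul_le_of_le_one_left hX0 hc1
  have hb0 : 0 ≤ min (I.influence X v + if v ∈ X then 1 else 0) (α / k * I.influence Y v) := by
    refine le_min ?_ hcY0
    split_ifs <;> linarith
  -- The minimum is the probability that `x` lies below it, so it remains to compare indicators. The
  -- point `x = 0`, where the quotient in the shift is a default value, is discarded as a null set.
  rw [← integral_ite_le hb0 ((min_le_right _ _).trans hcY1), integral_Icc_eq_integral_Ioc,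
    integral_Icc_eq_integral_Ioc]
  refine setIntegral_congr_fun measurableSet_Ioc fun x hx => ?_
  have hx0 : 0 < x := hx.1
  have hshift : k ≤ I.rawShift (Function.update t v x) S v ↔
      x ≤ α / k * I.influence (I.active (Function.update t v x) S) v := by
    rw [rawShift, Function.update_self, ← hα, Nat.le_floor_iff
      (mul_nonneg (div_nonneg hα0 hx0.le) (I.influence_nonneg _ _)), div_mul_eq_mul_div,
      div_mul_eq_mul_div, le_div_iff₀ hx0, le_div_iff₀ hk0, mul_comm]
  simp only [hshift, hcl, le_min_iff, hmem]
  congr 1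
  apply propext
  by_cases hv : v ∈ S
  -- For a seed, the extra 1 makes the first bound vacuous, since the second is at most 1.
  · simp only [hv, true_or, if_true]
    exact ⟨fun h => ⟨by linarith, h⟩, fun h => h.2⟩
  · simp only [hv, false_or, if_false, add_zero]
    split_ifs with h
    · exact ⟨fun h' => ⟨h, h'⟩, fun h' => h'.2⟩
    -- A shift by at least `k` without activation is impossible: since α/k ≤ 1, the threshold would
    -- have been met.
    · exact ⟨fun h' => absurd (h'.trans hcX) h, fun h' => absurd h'.1 h⟩

theorem integrable_le_rawShift (I : Election V C) (S : Finset V) (v : V) (k : ℕ) :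
    Integrable (fun t => if k ≤ I.rawShift t S v then (1 : ℝ) else 0) (thresholdLaw V) :=
  I.integrable_of_rawShift S (fun s => if k ≤ s v then (1 : ℝ) else 0)
    ((Set.toFinite {(1 : ℝ), 0}).subset (by
      rintro _ ⟨s, rfl⟩
      by_cases h : k ≤ s v <;> simp [h]))

/-- The probability that the target shifts by at least `k` in the list of `v`. -/
theorem isMonoSubmodular_integral_le_rawShift (I : Election V C) (v : V) {k : ℕ} (hk : 1 ≤ k) :
    IsMonoSubmodular fun S =>
      ∫ t, (if k ≤ I.rawShift t S v then (1 : ℝ) else 0) ∂thresholdLaw V := by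
  simp only [fun S => integral_thresholdLaw_update v (I.integrable_le_rawShift S v k),
    fun t S => I.integral_le_rawShift_update t S v hk]
  obtain ⟨hα0, hα1⟩ := I.rate_mem (I.rank v I.target)
  have hk0 : (0 : ℝ) < k := by exact_mod_cast hk
  refine I.isMonoSubmodular_integral_mixedRule v (fun X Y =>
    min (∑ u ∈ X, ((if I.graph.Adj u v then I.weight u v else 0) + if u = v then 1 else 0))
      (∑ u ∈ Y, I.rate (I.rank v I.target) / k * if I.graph.Adj u v then I.weight u v else 0))
    ?_ _ _ (fun _ => monotone_const) (fun _ _ _ h => h.elim)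
  refine isMonoSubmodular_min (fun u => ?_) (fun u => ?_)
  · exact mul_nonneg (by positivity) (I.edgeWeight_nonneg u v)
  · refine (mul_le_of_le_one_left (I.edgeWeight_nonneg u v) ?_).trans
      (le_add_of_nonneg_right (by split_ifs <;> simp))
    rw [div_le_one hk0]
    exact hα1.trans (by exact_mod_cast hk)

/-- Telescoping reduces the score to the tail events of the shift, with coefficients that are
nonnegative for monotone `g`. -/
theorem apply_min_eq_sum (g : ℕ → ℝ) (p s : ℕ) :
    g (min p s) = g 0 + ∑ k ∈ Finset.range p, (g (k + 1) - g k) * if k + 1 ≤ s then 1 else 0 := by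
  induction p with
  | zero => simp
  | succ p ih =>
    rw [Finset.sum_range_succ, ← add_assoc, ← ih]
    by_cases h : p + 1 ≤ s
    · simp [h, (Nat.le_succ p).trans h]
    · rw [min_eq_right (by omega), min_eq_right (by omega)]
      simp [h]

theorem isMonoSubmodular_constructiveScore (I : Election V C) :
    IsMonoSubmodular I.constructiveScore := by
  let p : V → ℕ := fun v => I.rank v I.target
  let g : V → ℕ → ℝ := fun v j =>
    I.scoring ⟨p v - j, (Nat.sub_le _ _).trans_lt (I.rank v I.target).isLt⟩
  have hg : ∀ v, Monotone (g v) := fun v i j h =>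
    Nat.cast_le.2 (I.scoring_antitone (Fin.mk_le_mk.2 (Nat.sub_le_sub_left h _)))
  have hscore : I.constructiveScore = fun S => ∑ v, (g v 0 + ∑ k ∈ Finset.range (p v),
      (g v (k + 1) - g v k) *
        ∫ t, (if k + 1 ≤ I.rawShift t S v then (1 : ℝ) else 0) ∂thresholdLaw V) := by
    funext S
    have h : ∀ t v, (I.scoring (I.upPos t S v) : ℝ) = g v 0 + ∑ k ∈ Finset.range (p v),
        (g v (k + 1) - g v k) * if k + 1 ≤ I.rawShift t S v then 1 else 0 :=
      fun t v => apply_min_eq_sum (g v) (p v) (I.rawShift t S v)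
    have hint : ∀ v k, Integrable (fun t => (g v (k + 1) - g v k) *
        if k + 1 ≤ I.rawShift t S v then (1 : ℝ) else 0) (thresholdLaw V) :=
      fun v k => (I.integrable_le_rawShift S v (k + 1)).const_mul _
    simp only [constructiveScore, h]
    rw [integral_finsetSum]
    · refine Finset.sum_congr rfl fun v _ => ?_
      rw [integral_add (integrable_const _) (integrable_finsetSum _ fun k _ => hint v k),
        integral_finsetSum _ fun k _ => hint v k]
      simp only [integral_const_mul, integral_const, probReal_univ, one_smul]
    · exact fun v _ => (integrable_const _).add (integrable_finsetSum _ fun k _ => hint v k)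
  rw [hscore]
  exact IsMonoSubmodular.sum _ fun v _ => (IsMonoSubmodular.const _).add
    (IsMonoSubmodular.sum _ fun k _ =>
      (I.isMonoSubmodular_integral_le_rawShift v (Nat.le_add_left 1 k)).const_mul
        (sub_nonneg.2 (hg v (Nat.le_succ k))))

end Score

/-! ### Comparing the margin with the target's loss, and the reduction by reversal. -/

section Margin

open scoped Classical

variable {V C : Type*} [Fintype V] [Fintype C]

theorem rank_target_le_downPos (I : Election V C) (t : V → ℝ) (S : Finset V) (v : V) :
    I.rank v I.target ≤ I.downPos t S v :=
  Fin.le_def.2 (Nat.le_add_right _ _)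

/-- The score that the target loses. -/
noncomputable def targetLoss (I : Election V C) (t : V → ℝ) (S : Finset V) : ℝ :=
  ∑ v, ((I.scoring (I.rank v I.target) : ℝ) - I.scoring (I.downPos t S v))

theorem targetLoss_nonneg (I : Election V C) (t : V → ℝ) (S : Finset V) : 0 ≤ I.targetLoss t S :=
  Finset.sum_nonneg fun v _ =>
    sub_nonneg.2 (Nat.cast_le.2 (I.scoring_antitone (I.rank_target_le_downPos t S v)))

theorem targetLoss_eq_score_sub (I : Election V C) (t : V → ℝ) (S : Finset V) :
    I.targetLoss t S = (I.score (fun v c => I.rank v c) I.target : ℝ) -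
      I.score (I.downRank t S) I.target := by
  simp [targetLoss, score, downRank]

theorem downRank_le_rank (I : Election V C) (t : V → ℝ) (S : Finset V) (v : V) {c : C}
    (hc : c ≠ I.target) : I.downRank t S v c ≤ I.rank v c := by
  rw [downRank, if_neg hc]
  split_ifs
  · exact Fin.le_def.2 (Nat.sub_le _ _)
  · exact le_rfl

/-- A candidate that is passed starts no lower than the target's final place and ends no higher than
its initial place, so its gain is at most the target's loss in that list. -/
theorem scoring_downRank_le (I : Election V C) (t : V → ℝ) (S : Finset V) (v : V) {c : C}
    (hc : c ≠ I.target) :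
    (I.scoring (I.downRank t S v c) : ℝ) ≤ I.scoring (I.rank v c) +
      ((I.scoring (I.rank v I.target) : ℝ) - I.scoring (I.downPos t S v)) := by
  rw [downRank, if_neg hc]
  split_ifs with h
  · have h1 : (I.scoring ⟨(I.rank v c : ℕ) - 1, (Nat.sub_le _ _).trans_lt (I.rank v c).isLt⟩ : ℝ)
        ≤ I.scoring (I.rank v I.target) :=
      Nat.cast_le.2 (I.scoring_antitone (Fin.le_def.2 (Nat.le_sub_one_of_lt h.1)))
    have h2 : (I.scoring (I.downPos t S v) : ℝ) ≤ I.scoring (I.rank v c) :=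
      Nat.cast_le.2 (I.scoring_antitone h.2)
    linarith
  · have : (I.scoring (I.downPos t S v) : ℝ) ≤ I.scoring (I.rank v I.target) :=
      Nat.cast_le.2 (I.scoring_antitone (I.rank_target_le_downPos t S v))
    linarith

theorem targetLoss_le_margin_sub (I : Election V C) (t : V → ℝ) (S : Finset V) :
    I.targetLoss t S ≤ I.margin (I.downRank t S) - I.margin (fun v c => I.rank v c) := by
  have h : (Finset.univ.erase I.target).sup (I.score fun v c => I.rank v c) ≤
      (Finset.univ.erase I.target).sup (I.score (I.downRank t S)) :=
    Finset.sup_mono_fun fun c hc => Finset.sum_le_sum fun v _ =>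
      I.scoring_antitone (I.downRank_le_rank t S v (Finset.ne_of_mem_erase hc))
  have h' : (((Finset.univ.erase I.target).sup (I.score fun v c => I.rank v c) : ℕ) : ℝ) ≤
      ((Finset.univ.erase I.target).sup (I.score (I.downRank t S)) : ℕ) := Nat.cast_le.2 h
  rw [targetLoss_eq_score_sub, margin, margin]
  linarith

theorem margin_sub_le_targetLoss (I : Election V C) (t : V → ℝ) (S : Finset V) :
    I.margin (I.downRank t S) - I.margin (fun v c => I.rank v c) ≤ 2 * I.targetLoss t S := by
  have h : (((Finset.univ.erase I.target).sup (I.score (I.downRank t S)) : ℕ) : ℝ) ≤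
      ((Finset.univ.erase I.target).sup (I.score fun v c => I.rank v c) : ℕ) +
        I.targetLoss t S := by
    rcases (Finset.univ.erase I.target).eq_empty_or_nonempty with he | hne
    -- Without opponents both suprema are 0.
    · simpa [he] using I.targetLoss_nonneg t S
    · obtain ⟨c, hc, hsup⟩ := Finset.exists_mem_eq_sup _ hne (I.score (I.downRank t S))
      have h1 : ((I.score (fun v c => I.rank v c) c : ℕ) : ℝ) ≤
          ((Finset.univ.erase I.target).sup (I.score fun v c => I.rank v c) : ℕ) :=
        Nat.cast_le.2 (Finset.le_sup (f := I.score fun v c => I.rank v c) hc)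
      have h2 : (I.score (I.downRank t S) c : ℝ) ≤
          I.score (fun v c => I.rank v c) c + I.targetLoss t S := by
        simp only [score, targetLoss, Nat.cast_sum, ← Finset.sum_add_distrib]
        exact Finset.sum_le_sum fun v _ =>
          I.scoring_downRank_le t S v (Finset.ne_of_mem_erase hc)
      rw [hsup]
      linarith
  have h' := I.targetLoss_eq_score_sub t S
  rw [margin, margin]
  linarith

theorem reverse_rawShift (I : Election V C) (t : V → ℝ) (S : Finset V) (v : V) :
    I.reverse.rawShift t S v = I.rawShift t S v := by
  have h : I.reverse.rate (I.reverse.rank v I.reverse.target) = I.rate (I.rank v I.target) :=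
    congrArg I.rate (Fin.rev_rev _)
  rw [rawShift, h]
  rfl

/-- Reversal exchanges moving up and moving down, and the caps agree: the room above the target in
the reversed list is the room below it in the original one. -/
theorem rev_reverse_upPos (I : Election V C) (t : V → ℝ) (S : Finset V) (v : V) :
    (I.reverse.upPos t S v).rev = I.downPos t S v := by
  have h := (I.rank v I.target).isLt
  have hr : (I.reverse.rank v I.reverse.target : ℕ) =
      Fintype.card C - (I.rank v I.target + 1) := Fin.val_rev _
  ext
  simp only [upPos, downPos, Fin.val_rev, reverse_rawShift, hr]
  omega

theorem reverse_scoring_upPos (I : Election V C) (t : V → ℝ) (S : Finset V) (v : V) :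
    (I.reverse.scoring (I.reverse.upPos t S v) : ℝ) =
      (Finset.univ.sup I.scoring : ℕ) - I.scoring (I.downPos t S v) := by
  rw [← rev_reverse_upPos]
  exact Nat.cast_sub (Finset.le_sup (Finset.mem_univ _))

/-- The score of the target in the reversed instance that is due to the initial lists. -/
noncomputable def reverseBase (I : Election V C) : ℝ :=
  ∑ v : V, (((Finset.univ.sup I.scoring : ℕ) : ℝ) - I.scoring (I.rank v I.target))

theorem sum_reverse_scoring_upPos (I : Election V C) (t : V → ℝ) (S : Finset V) :
    ∑ v, (I.reverse.scoring (I.reverse.upPos t S v) : ℝ) = I.reverseBase + I.targetLoss t S := by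
  simp only [reverse_scoring_upPos, reverseBase, targetLoss, ← Finset.sum_add_distrib]
  exact Finset.sum_congr rfl fun v _ => by ring

theorem integrable_targetLoss (I : Election V C) (S : Finset V) :
    Integrable (fun t => I.targetLoss t S) (thresholdLaw V) := by
  have h := (I.reverse.integrable_constructiveScore S).sub (integrable_const I.reverseBase)
  refine h.congr (Filter.Eventually.of_forall fun t => ?_)
  simp [sum_reverse_scoring_upPos]

theorem reverse_constructiveScore (I : Election V C) (S : Finset V) :
    I.reverse.constructiveScore S =
      I.reverseBase + ∫ t, I.targetLoss t S ∂thresholdLaw V := by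
  simp only [constructiveScore, sum_reverse_scoring_upPos]
  rw [integral_add (integrable_const _) (I.integrable_targetLoss S)]
  simp

end Margin

end Election

/-! ### The approximation guarantee. -/

theorem mainTheorem2 {V C : Type*} [Fintype V] [Fintype C] (I : Election V C) (B : ℕ) :
    (∃ A : Finset V, IsGreedyOutput I.reverse.constructiveScore B A) ∧
    ∀ A : Finset V, IsGreedyOutput I.reverse.constructiveScore B A →
      A.card ≤ B ∧
      ∀ S : Finset V, S.card ≤ B →
        1 / 2 * (1 - 1 / Real.exp 1) * I.destructiveMoV S ≤ I.destructiveMoV A := by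
  refine ⟨exists_greedyRun _ (min_le_right _ _), fun A hA => ⟨?_, fun S hS => ?_⟩⟩
  · exact (GreedyRun.card_eq hA).trans_le (min_le_left _ _)
  have happrox := hA.approx I.reverse.isMonoSubmodular_constructiveScore hS
  simp only [I.reverse_constructiveScore] at happrox
  -- The greedy bound concerns increments over ∅, where the constant base cancels. Nonnegativity of
  -- L(∅) suffices to pass from increments to L itself, because 1 - 1/e ≤ 1.
  have hempty : 0 ≤ ∫ t, I.targetLoss t ∅ ∂Election.thresholdLaw V :=
    integral_nonneg fun t => I.targetLoss_nonneg t ∅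
  have hlower : ∫ t, I.targetLoss t A ∂Election.thresholdLaw V ≤ I.destructiveMoV A :=
    integral_mono (I.integrable_targetLoss A) (I.integrable_destructiveMoV A)
      fun t => I.targetLoss_le_margin_sub t A
  have hupper : I.destructiveMoV S ≤ 2 * ∫ t, I.targetLoss t S ∂Election.thresholdLaw V := by
    rw [← integral_const_mul]
    exact integral_mono (I.integrable_destructiveMoV S) ((I.integrable_targetLoss S).const_mul 2)
      fun t => I.margin_sub_le_targetLoss t S
  have he0 : 0 ≤ 1 / Real.exp 1 := by positivity
  have he1 : 0 ≤ 1 - 1 / Real.exp 1 := by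
    rw [sub_nonneg, div_le_one (Real.exp_pos 1)]
    exact Real.one_le_exp zero_le_one
  have h1 := mul_le_mul_of_nonneg_left hupper he1
  have h2 := mul_nonneg he0 hempty
  linarith
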